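/- Let $P$ be a poset that admits a strictly order-preserving map $d\colon P\to\mathbb N$ (a filtered poset), regarded as a category with a unique arrow $p\to q$ if and only if $p\le q$, let $R$ be a commutative ring with unit, and let $F\colon P^{\mathrm{op}}\to R\text{-}\mathrm{Mod}$ be a functor. Write $H^k(P;F)$ for the higher limits of $F$, that is, the right derived functors of $\lim\colon \mathrm{Fun}(P^{\mathrm{op}},R\text{-}\mathrm{Mod})\to R\text{-}\mathrm{Mod}$ evaluated at $F$, and let $\mathrm{Ch}(R)$ be the category of ($\mathbb Z$-graded) cochain complexes of $R$-modules. In $\mathrm{Fun}(P^{\mathrm{op}},\mathrm{Ch}(R))$ call $\eta\colon X\to Y$ a weak equivalence if every $\eta_p\colon X(p)\to Y(p)$ is a quasi-isomorphism, and a fibration if for every $p\in P$ the induced map $$X(p)\longrightarrow Y(p)\times_{\lim_{P_{<p}}Y}\lim_{P_{<p}}X$$ is an epimorphism. An object $X$ is fibrant if the map from $X$ to the terminal object is a fibration. A functor $F\colon P^{\mathrm{op}}\to R\text{-}\mathrm{Mod}$ is regarded as a functor to $\mathrm{Ch}(R)$ concentrated in degree $0$, and is called fibrant if it is so as such a functor.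 A fibrant replacement of $F$ is a fibrant functor $\mathbf RF\colon P^{\mathrm{op}}\to\mathrm{Ch}(R)$ together with a weak equivalence $F\to\mathbf RF$. The height of a functor $X\colon P^{\mathrm{op}}\to\mathrm{Ch}(R)$ is $\mathrm h(X)=\sup_{p\in P}\mathrm h(X(p))\in\mathbb Z\cup\{\pm\infty\}$, where, for a complex $C$, $\mathrm h(C)=\sup\{k\in\mathbb Z: C^k\neq 0\}$. Then: 1. If $\mathbf RF$ is a fibrant replacement of $F$ and $\mathrm h(\mathbf RF)=n$, then $H^k(P;F)=0$ for every integer $k\ge 0$ with $k>n$. 2. In particular, if $F$ is fibrant, then $F$ is $\lim$-acyclic: $H^k(P;F)=0$ for every $k>0$. Here $F$ is fibrant if and only if, for every $p\in P$, the matching map $F(p)\to\lim_{P_{<p}}F$ is surjective. -/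

import Mathlib

open CategoryTheory CategoryTheory.Limits Opposite

universe u v w

/-- A poset is filtered if it admits a strictly order-preserving map to the natural numbers. -/
def IsFilteredPoset (P : Type u) [PartialOrder P] : Prop :=
  ∃ d : P → ℕ, StrictMono d

noncomputable section

namespace PosetFunctor

section Matching

variable {P : Type w} [PartialOrder P] {C : Type u} [Category.{v} C] [HasLimitsOfSize.{w, w} C]

/-- The inclusion of the subposet `P_{<p}` in `P`. -/
@[simps]
def incl (p : P) : {q : P // q < p} ⥤ P where
  obj q := q.1
  map f := homOfLE (leOfHom f)

/-- The restriction of a functor on `Pᵒᵖ` to `(P_{<p})ᵒᵖ`. -/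
abbrev restr (X : Pᵒᵖ ⥤ C) (p : P) : {q : P // q < p}ᵒᵖ ⥤ C :=
  (incl p).op ⋙ X

/-- The matching object `lim_{P_{<p}} X`. -/
abbrev matchingObj (X : Pᵒᵖ ⥤ C) (p : P) : C :=
  limit (restr X p)

/-- The cone over `X|_{P_{<p}}` with apex `X(p)` given by the structure maps `X(p) ⟶ X(q)`. -/
@[simps]
def matchingCone (X : Pᵒᵖ ⥤ C) (p : P) : Cone (restr X p) where
  pt := X.obj (op p)
  π :=
    { app := fun q => X.map (homOfLE (le_of_lt q.unop.2) : (incl p).obj q.unop ⟶ p).op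
      naturality := fun q r f => by
        simp only [Functor.const_obj_obj, Functor.const_obj_map, Category.id_comp,
          Functor.comp_map]
        exact X.map_comp _ _ }

/-- The matching map `X(p) ⟶ lim_{P_{<p}} X`. -/
def matchingMap (X : Pᵒᵖ ⥤ C) (p : P) : X.obj (op p) ⟶ matchingObj X p :=
  limit.lift (restr X p) (matchingCone X p)

theorem matchingMap_π (X : Pᵒᵖ ⥤ C) (p : P) (q : {q : P // q < p}ᵒᵖ) :
    matchingMap X p ≫ limit.π (restr X p) q =
      X.map (homOfLE (le_of_lt q.unop.2) : (incl p).obj q.unop ⟶ p).op :=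
  limit.lift_π (matchingCone X p) q

/-- The map `lim_{P_{<p}} X ⟶ lim_{P_{<p}} Y` induced by a natural transformation `X ⟶ Y`. -/
def matchingObjMap {X Y : Pᵒᵖ ⥤ C} (η : X ⟶ Y) (p : P) : matchingObj X p ⟶ matchingObj Y p :=
  limMap (Functor.whiskerLeft (incl p).op η)

theorem matchingObjMap_π {X Y : Pᵒᵖ ⥤ C} (η : X ⟶ Y) (p : P) (q : {q : P // q < p}ᵒᵖ) :
    matchingObjMap η p ≫ limit.π (restr Y p) q =
      limit.π (restr X p) q ≫ η.app ((incl p).op.obj q) :=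
  limMap_π _ q

theorem matching_naturality {X Y : Pᵒᵖ ⥤ C} (η : X ⟶ Y) (p : P) :
    η.app (op p) ≫ matchingMap Y p = matchingMap X p ≫ matchingObjMap η p := by
  refine limit.hom_ext fun q => ?_
  rw [Category.assoc, Category.assoc, matchingMap_π, matchingObjMap_π, ← Category.assoc,
    matchingMap_π]
  exact (η.naturality _).symm

/-- The relative matching map `X(p) ⟶ Y(p) ×_{lim_{P_{<p}} Y} lim_{P_{<p}} X`. -/
def relMatchingMap [HasPullbacks C] {X Y : Pᵒᵖ ⥤ C} (η : X ⟶ Y) (p : P) :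
    X.obj (op p) ⟶ pullback (matchingMap Y p) (matchingObjMap η p) :=
  pullback.lift (η.app (op p)) (matchingMap X p) (matching_naturality η p)

end Matching

section Complexes

variable {P : Type u} [PartialOrder P] {R : Type u} [CommRing R]

/-- Weak equivalences: the objectwise quasi-isomorphisms. -/
def IsWeakEquivalence {X Y : Pᵒᵖ ⥤ CochainComplex (ModuleCat.{u} R) ℤ} (η : X ⟶ Y) : Prop :=
  ∀ p : P, QuasiIso (η.app (op p))

/-- Fibrations: all relative matching maps are epimorphisms (of cochain complexes). -/
def IsFibration {X Y : Pᵒᵖ ⥤ CochainComplex (ModuleCat.{u} R) ℤ} (η : X ⟶ Y) : Prop :=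
  ∀ p : P, Epi (relMatchingMap η p)

/-- Fibrant objects: the map to the terminal object is a fibration. -/
def IsFibrant (X : Pᵒᵖ ⥤ CochainComplex (ModuleCat.{u} R) ℤ) : Prop :=
  IsFibration (terminal.from X)

/-- A functor to modules regarded as a functor to cochain complexes concentrated in degree `0`. -/
def inDegreeZero (F : Pᵒᵖ ⥤ ModuleCat.{u} R) : Pᵒᵖ ⥤ CochainComplex (ModuleCat.{u} R) ℤ :=
  F ⋙ HomologicalComplex.single (ModuleCat.{u} R) (ComplexShape.up ℤ) 0

/-- `RF` is a fibrant replacement of `F`: it is fibrant and there is a weak equivalence from `F`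
(placed in degree `0`) to `RF`. -/
def IsFibrantReplacement (F : Pᵒᵖ ⥤ ModuleCat.{u} R)
    (RF : Pᵒᵖ ⥤ CochainComplex (ModuleCat.{u} R) ℤ) : Prop :=
  IsFibrant RF ∧ ∃ η : inDegreeZero F ⟶ RF, IsWeakEquivalence η

/-- The height of a cochain complex: the largest `n` with `Cⁿ ≠ 0`. It is `⊥` for the zero complex
and `⊤` for a complex that is not bounded above. -/
def complexHeight (C : CochainComplex (ModuleCat.{u} R) ℤ) : WithBot (WithTop ℤ) :=
  ⨆ k : {k : ℤ // ¬ IsZero (C.X k)}, ((k.1 : WithTop ℤ) : WithBot (WithTop ℤ))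

/-- The height of a functor to cochain complexes: the supremum of the heights of its values. -/
def height (X : Pᵒᵖ ⥤ CochainComplex (ModuleCat.{u} R) ℤ) : WithBot (WithTop ℤ) :=
  ⨆ p : P, complexHeight (X.obj (op p))

end Complexes

section HigherLimits

variable (P : Type u) [PartialOrder P] (R : Type u) [CommRing R]

/-- The limit functor from functors `Pᵒᵖ ⥤ R-Mod` to `R-Mod`. -/
abbrev limFunctor : (Pᵒᵖ ⥤ ModuleCat.{u} R) ⥤ ModuleCat.{u} R :=
  lim

instance limFunctor_additive : (limFunctor P R).Additive where
  map_add {X Y f g} := by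
    refine limit.hom_ext fun q => ?_
    simp [limFunctor]

instance isGrothendieckAbelian_functors :
    IsGrothendieckAbelian.{u} (Pᵒᵖ ⥤ ModuleCat.{u} R) where
  ab5OfSize := { ofShape := fun J _ _ => inferInstance }

instance enoughInjectives_functors : EnoughInjectives (Pᵒᵖ ⥤ ModuleCat.{u} R) :=
  IsGrothendieckAbelian.enoughInjectives.{u}

variable {P R}

/-- The higher limits `H^k(P; F)`: the right derived functors of the limit functor, at `F`. -/
def higherLimit (F : Pᵒᵖ ⥤ ModuleCat.{u} R) (k : ℕ) : ModuleCat.{u} R :=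
  ((limFunctor P R).rightDerived k).obj F

end HigherLimits

end PosetFunctor

end

/-! A functor to complexes is fibrant exactly when each of its degrees is flasque: compatible
families over `P_{<p}` extend to `p` (`isFibrant_iff`). Higher limits are controlled by `Ext` from
the constant functor `R`, so it suffices to kill these groups.

Flasque functors have no positive `Ext` from `R` (`subsingleton_ext_of_isFlasqueAt`). Injectives are
flasque, so one shifts dimension along an injective embedding. Its cokernel is again flasque, and
lifting along a surjection with flasque kernel is well-founded recursion on `P`
(`exists_compatible_lift`).

Let `X` be degreewise flasque and exact off degree 0, with `H^0 = F`. Since `X` may be unbounded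
below, `F` is not simply resolved by its terms. However, `X^0/B^0` has a left resolution by flasque
functors, possibly infinite, and is therefore flasque (`IsFlasqueAt.of_resolution`). From `0 ⟶ F ⟶
X^0/B^0 ⟶ Z^1 ⟶ 0` and the sequences `0 ⟶ Z^j ⟶ X^j ⟶ Z^{j+1} ⟶ 0`, the group `Ext^k(R, F)`, for `k
> 0`, is pushed down to `Hom(R, Z^k)`, which vanishes once `X^k = 0`. -/

noncomputable section

namespace PosetFunctor

/-! ### Flasque functors, in terms of elements -/

section Sections

variable {P : Type u} [PartialOrder P] {R : Type u} [CommRing R]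

/-- The family `s` is compatible with the structure maps of `A` over the elements of `Q`. -/
def IsCompatibleOn (A : Pᵒᵖ ⥤ ModuleCat.{u} R) (Q : P → Prop) (s : ∀ q : P, A.obj (op q)) : Prop :=
  ∀ (q r : P) (h : r ≤ q), Q q → A.map (homOfLE h).op (s q) = s r

/-- Every compatible family on `P_{<p}` extends to an element over `p`. -/
def IsFlasqueAt (A : Pᵒᵖ ⥤ ModuleCat.{u} R) (p : P) : Prop :=
  ∀ s : ∀ q : P, A.obj (op q), IsCompatibleOn A (· < p) s →
    ∃ x : A.obj (op p), ∀ (q : P) (h : q < p), A.map (homOfLE h.le).op x = s q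

/-- Surjectivity of the relative matching map at `p`, in terms of elements. -/
def IsMatchingSurjectiveAt {A B : Pᵒᵖ ⥤ ModuleCat.{u} R} (f : A ⟶ B) (p : P) : Prop :=
  ∀ s : ∀ q : P, A.obj (op q), IsCompatibleOn A (· < p) s →
    ∀ b : B.obj (op p), (∀ (q : P) (h : q < p), B.map (homOfLE h.le).op b = f.app (op q) (s q)) →
      ∃ a : A.obj (op p), f.app (op p) a = b ∧
        ∀ (q : P) (h : q < p), A.map (homOfLE h.le).op a = s q

theorem map_homOfLE_comp (A : Pᵒᵖ ⥤ ModuleCat.{u} R) {p q r : P} (h : q ≤ p) (h' : r ≤ q)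
    (x : A.obj (op p)) :
    A.map (homOfLE h').op (A.map (homOfLE h).op x) = A.map (homOfLE (h'.trans h)).op x := by
  rw [← ConcreteCategory.comp_apply, ← A.map_comp]
  rfl

theorem map_homOfLE_refl (A : Pᵒᵖ ⥤ ModuleCat.{u} R) {p : P} (h : p ≤ p) (x : A.obj (op p)) :
    A.map (homOfLE h).op x = x := by
  have : A.map (homOfLE h).op = 𝟙 _ := A.map_id _
  rw [this]; rfl

theorem app_map {A B : Pᵒᵖ ⥤ ModuleCat.{u} R} (f : A ⟶ B) {p q : P} (h : q ≤ p)
    (x : A.obj (op p)) :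
    f.app (op q) (A.map (homOfLE h).op x) = B.map (homOfLE h).op (f.app (op p) x) :=
  NatTrans.naturality_apply f (homOfLE h).op x

theorem IsFilteredPoset.wellFounded (hP : IsFilteredPoset P) :
    WellFounded (fun q p : P => q < p) := by
  obtain ⟨d, hd⟩ := hP
  exact Subrelation.wf (fun h => hd h) (measure d).wf

/-- Compatible families over a lower set lift along a map whose relative matching maps are
surjective there. -/
theorem exists_compatible_lift (hP : IsFilteredPoset P) {A B : Pᵒᵖ ⥤ ModuleCat.{u} R} (f : A ⟶ B)
    (Q : P → Prop) (hQ : ∀ p q : P, q ≤ p → Q p → Q q)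
    (hf : ∀ p : P, Q p → IsMatchingSurjectiveAt f p)
    (t : ∀ q : P, B.obj (op q)) (ht : IsCompatibleOn B Q t) :
    ∃ s : ∀ q : P, A.obj (op q), IsCompatibleOn A Q s ∧ ∀ q : P, Q q → f.app (op q) (s q) = t q := by
  classical
  have wf := IsFilteredPoset.wellFounded hP
  let good (p : P) (rec : ∀ q : P, q < p → A.obj (op q)) (a : A.obj (op p)) : Prop :=
    f.app (op p) a = t p ∧ ∀ (q : P) (h : q < p), A.map (homOfLE h.le).op a = rec q h
  -- The recursion is total because of the junk value 0; `key` shows that it is never taken on `Q`.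
  let s : ∀ p : P, A.obj (op p) := wf.fix fun p rec =>
    if h : ∃ a, good p rec a then h.choose else 0
  have hs (p : P) : s p = if h : ∃ a, good p (fun q _ => s q) a then h.choose else 0 :=
    wf.fix_eq _ p
  have key : ∀ p : P, Q p → good p (fun q _ => s q) (s p) := by
    intro p
    induction p using wf.induction with
    | _ p ih =>
      intro hp
      have hex : ∃ a, good p (fun q _ => s q) a := by
        let s' : ∀ q : P, A.obj (op q) := s
        refine hf p hp s (fun q r h hq => ?_) (t p) (fun q h => ?_)
        · obtain rfl | h' := h.eq_or_lt
          · exact map_homOfLE_refl A h _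
          · exact (ih q hq (hQ p q hq.le hp)).2 r h'
        · rw [(ih q h (hQ p q h.le hp)).1]
          exact ht p q h.le hp
      rw [hs p, dif_pos hex]
      exact hex.choose_spec
  refine ⟨s, fun q r h hq => ?_, fun q hq => (key q hq).1⟩
  obtain rfl | h' := h.eq_or_lt
  · exact map_homOfLE_refl A h _
  · exact (key q hq).2 r h'

/-- A surjection with flasque kernel has surjective relative matching maps. -/
theorem IsMatchingSurjectiveAt.of_kernel {A B C : Pᵒᵖ ⥤ ModuleCat.{u} R} (f : A ⟶ B) (g : B ⟶ C)
    (hf : ∀ p, Function.Injective (f.app (op p)))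
    (hfg : ∀ p, Function.Exact (f.app (op p)) (g.app (op p)))
    (hg : ∀ p, Function.Surjective (g.app (op p)))
    {p : P} (hA : IsFlasqueAt A p) : IsMatchingSurjectiveAt g p := by
  classical
  intro s hs c hc
  obtain ⟨b, hb⟩ := hg p c
  -- An arbitrary lift `b` misses `s` by a compatible family in the kernel; flasqueness extends that
  -- family to a correction of `b`.
  have hk (q : P) (h : q < p) :
      ∃ a, f.app (op q) a = s q - B.map (homOfLE h.le).op b := by
    refine ((hfg q) _).1 ?_
    rw [map_sub, ← hc q h, app_map, hb, sub_self]
  let k : ∀ q : P, A.obj (op q) := fun q => if h : q < p then (hk q h).choose else 0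
  have hkk (q : P) (h : q < p) : f.app (op q) (k q) = s q - B.map (homOfLE h.le).op b := by
    simp only [k, dif_pos h]
    exact (hk q h).choose_spec
  obtain ⟨x, hx⟩ := hA k (fun q r h hq => hf r (by
    rw [app_map, hkk q hq, hkk r (h.trans_lt hq), map_sub, hs q r h hq, map_homOfLE_comp]))
  refine ⟨b + f.app (op p) x, ?_, fun q h => ?_⟩
  · rw [map_add, hb, (hfg p).apply_apply_eq_zero, add_zero]
  · rw [map_add, ← app_map, hx q h, hkk q h, add_sub_cancel]

/-- The target of a map from a flasque functor is flasque at `p` if the relative matching maps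
are surjective below `p`. -/
theorem IsFlasqueAt.of_isMatchingSurjectiveAt (hP : IsFilteredPoset P)
    {A B : Pᵒᵖ ⥤ ModuleCat.{u} R} (f : A ⟶ B) {p : P} (hA : IsFlasqueAt A p)
    (hf : ∀ q : P, q < p → IsMatchingSurjectiveAt f q) : IsFlasqueAt B p := by
  intro t ht
  obtain ⟨s, hs, hst⟩ := exists_compatible_lift hP f (· < p) (fun _ _ h h' => h.trans_lt h') hf t ht
  obtain ⟨x, hx⟩ := hA s hs
  refine ⟨f.app (op p) x, fun q h => ?_⟩
  rw [← app_map, hx q h, hst q h]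

/-- If `0 ⟶ E (i + 1) ⟶ K i ⟶ E i ⟶ 0` is exact for all `i` and all `K i` are flasque, so are
all `E i`. -/
theorem IsFlasqueAt.of_resolution (hP : IsFilteredPoset P) (E K : ℕ → (Pᵒᵖ ⥤ ModuleCat.{u} R))
    (f : ∀ i, E (i + 1) ⟶ K i) (g : ∀ i, K i ⟶ E i)
    (hf : ∀ i p, Function.Injective ((f i).app (op p)))
    (hfg : ∀ i p, Function.Exact ((f i).app (op p)) ((g i).app (op p)))
    (hg : ∀ i p, Function.Surjective ((g i).app (op p)))
    (hK : ∀ i p, IsFlasqueAt (K i) p) (i : ℕ) (p : P) : IsFlasqueAt (E i) p := by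
  -- Index `i` at `p` needs index `i + 1` only strictly below `p`. Induction on `p`, for all `i` at
  -- once, therefore terminates although the resolution does not.
  have key : ∀ p i, IsMatchingSurjectiveAt (g i) p := by
    intro p
    induction p using (IsFilteredPoset.wellFounded hP).induction with
    | _ p ih =>
      exact fun i => .of_kernel (f i) (g i) (hf i) (hfg i) (hg i)
        (.of_isMatchingSurjectiveAt hP (g (i + 1)) (hK _ p) fun q hq => ih q hq _)
  exact .of_isMatchingSurjectiveAt hP (g i) (hK i p) fun q _ => key q i

theorem IsFlasqueAt.of_retract {A B : Pᵒᵖ ⥤ ModuleCat.{u} R} (i : A ⟶ B) (r : B ⟶ A)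
    (h : i ≫ r = 𝟙 A) {p : P} (hB : IsFlasqueAt B p) : IsFlasqueAt A p := by
  intro s hs
  obtain ⟨x, hx⟩ := hB (fun q => i.app (op q) (s q)) (fun q q' hq hp => by
    rw [← app_map, hs q q' hq hp])
  refine ⟨r.app (op p) x, fun q hq => ?_⟩
  rw [← app_map, hx q hq, ← ConcreteCategory.comp_apply, ← NatTrans.comp_app, h]
  rfl

/-- The functor `p ↦ ∏_{q ≤ p} A(q)`, with the projections as structure maps. -/
@[simps]
def godement (A : Pᵒᵖ ⥤ ModuleCat.{u} R) : Pᵒᵖ ⥤ ModuleCat.{u} R where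
  obj p := ModuleCat.of R (∀ q : {q : P // q ≤ p.unop}, A.obj (op q.1))
  map {p p'} h := ModuleCat.ofHom
    (LinearMap.pi fun q => LinearMap.proj (⟨q.1, q.2.trans (leOfHom h.unop)⟩ : {q : P // q ≤ p.unop}))

/-- The embedding of a functor in its Godement functor. -/
def toGodement (A : Pᵒᵖ ⥤ ModuleCat.{u} R) : A ⟶ godement A where
  app p := ModuleCat.ofHom (LinearMap.pi fun q => (A.map (homOfLE q.2 : q.1 ⟶ p.unop).op).hom)
  naturality p p' h := by
    ext x
    funext q
    exact map_homOfLE_comp A (leOfHom h.unop) q.2 x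

instance mono_toGodement (A : Pᵒᵖ ⥤ ModuleCat.{u} R) : Mono (toGodement A) := by
  have (p : Pᵒᵖ) : Mono ((toGodement A).app p) := by
    rw [ModuleCat.mono_iff_injective]
    intro x y hxy
    have := congrFun hxy (⟨p.unop, le_rfl⟩ : {q : P // q ≤ p.unop})
    change A.map (homOfLE le_rfl).op x = A.map (homOfLE le_rfl).op y at this
    rwa [map_homOfLE_refl, map_homOfLE_refl] at this
  exact NatTrans.mono_of_mono_app _

/-- Compatibility forces the coordinate at `r < p` to be the diagonal coordinate of `s r`. The
coordinate at `p` is unconstrained and set to 0. -/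
theorem isFlasqueAt_godement (A : Pᵒᵖ ⥤ ModuleCat.{u} R) (p : P) : IsFlasqueAt (godement A) p := by
  classical
  intro s hs
  let x : ∀ r : {r : P // r ≤ p}, A.obj (op r.1) := fun r =>
    if r.1 < p then (s r.1 : ∀ q : {q : P // q ≤ r.1}, A.obj (op q.1)) ⟨r.1, le_rfl⟩ else 0
  refine ⟨x, fun q hq => ?_⟩
  funext r
  have := congrFun (hs q r.1 r.2 hq) (⟨r.1, le_rfl⟩ : {r' : P // r' ≤ r.1})
  change x ⟨r.1, _⟩ = _
  simp only [x]
  rw [if_pos (r.2.trans_lt hq)]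
  exact this.symm

/-- An injective is a retract of its Godement functor. -/
theorem isFlasqueAt_of_injective (J : Pᵒᵖ ⥤ ModuleCat.{u} R) [Injective J] (p : P) :
    IsFlasqueAt J p :=
  (isFlasqueAt_godement J p).of_retract (toGodement J) (Injective.factorThru (𝟙 J) (toGodement J))
    (Injective.comp_factorThru _ _)

end Sections

open Abelian

/-! ### Dimension shifting for `Ext` -/

section Ext

variable {A : Type u} [Category.{v} A] [Abelian A] [HasExt.{w} A]

theorem subsingleton_ext_of_forall_eq_zero {c F : A} {n : ℕ} (h : ∀ x : Ext c F n, x = 0) :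
    Subsingleton (Ext c F n) :=
  ⟨fun x y => (h x).trans (h y).symm⟩

theorem subsingleton_ext_of_isZero (c : A) {F : A} (hF : IsZero F) (n : ℕ) :
    Subsingleton (Ext c F n) :=
  subsingleton_ext_of_forall_eq_zero fun x => by
    rw [← x.comp_mk₀_id, hF.eq_of_src (𝟙 F) 0, Ext.mk₀_zero, Ext.comp_zero]

theorem subsingleton_ext_of_iso (c : A) {F G : A} (e : F ≅ G) (n : ℕ)
    [Subsingleton (Ext c F n)] : Subsingleton (Ext c G n) :=
  subsingleton_ext_of_forall_eq_zero fun x => by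
    rw [← x.comp_mk₀_id, ← e.inv_hom_id, ← Ext.mk₀_comp_mk₀,
      ← Ext.comp_assoc_of_second_deg_zero,
      Subsingleton.elim (x.comp (Ext.mk₀ e.inv) (add_zero n)) 0, Ext.zero_comp]

theorem subsingleton_ext_X₁ (c : A) {S : ShortComplex A} (hS : S.ShortExact) (n : ℕ)
    [Subsingleton (Ext c S.X₂ (n + 1))] [Subsingleton (Ext c S.X₃ n)] :
    Subsingleton (Ext c S.X₁ (n + 1)) :=
  subsingleton_ext_of_forall_eq_zero fun x => by
    obtain ⟨y, rfl⟩ := Ext.covariant_sequence_exact₁ c hS x (Subsingleton.elim _ _) rfl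
    rw [Subsingleton.elim y 0, Ext.zero_comp]

/-- The connecting map from `Hom(c, X₃)` is onto because `Ext¹(c, X₂) = 0`, and it kills every map
that lifts to `X₂`. -/
theorem subsingleton_ext_one_X₁ (c : A) {S : ShortComplex A} (hS : S.ShortExact)
    [Subsingleton (Ext c S.X₂ 1)] (hc : ∀ φ : c ⟶ S.X₃, ∃ ψ : c ⟶ S.X₂, ψ ≫ S.g = φ) :
    Subsingleton (Ext c S.X₁ 1) :=
  subsingleton_ext_of_forall_eq_zero fun x => by
    obtain ⟨y, rfl⟩ :=
      Ext.covariant_sequence_exact₁ c hS x (Subsingleton.elim _ _) (n₀ := 0) rfl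
    obtain ⟨φ, rfl⟩ := (Ext.mk₀_bijective _ _).surjective y
    obtain ⟨ψ, rfl⟩ := hc φ
    rw [← Ext.mk₀_comp_mk₀, Ext.comp_assoc_of_second_deg_zero, hS.comp_extClass, Ext.comp_zero]

end Ext

/-! ### Acyclicity of flasque functors -/

section Acyclic

variable {P : Type u} [PartialOrder P] {R : Type u} [CommRing R]

theorem shortExact_of_forall_app {S : ShortComplex (Pᵒᵖ ⥤ ModuleCat.{u} R)}
    (h : ∀ p, (S.map ((evaluation Pᵒᵖ (ModuleCat.{u} R)).obj p)).ShortExact) : S.ShortExact where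
  exact := by
    rw [ShortComplex.exact_iff_isZero_homology, Functor.isZero_iff]
    intro p
    exact (((S.map _).exact_iff_isZero_homology).1 (h p).exact).of_iso
      (S.mapHomologyIso ((evaluation Pᵒᵖ (ModuleCat.{u} R)).obj p)).symm
  mono_f := by
    have (p : Pᵒᵖ) : Mono (S.f.app p) := (h p).mono_f
    exact NatTrans.mono_of_mono_app _
  epi_g := by
    have (p : Pᵒᵖ) : Epi (S.g.app p) := (h p).epi_g
    exact NatTrans.epi_of_epi_app _

theorem shortExact_app {S : ShortComplex (Pᵒᵖ ⥤ ModuleCat.{u} R)} (hS : S.ShortExact) (p : P) :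
    (S.map ((evaluation Pᵒᵖ (ModuleCat.{u} R)).obj (op p))).ShortExact :=
  hS.map_of_exact _

/-- A short exact sequence of functors with flasque kernel has surjective relative matching maps
on the right. -/
theorem IsMatchingSurjectiveAt.of_shortExact {S : ShortComplex (Pᵒᵖ ⥤ ModuleCat.{u} R)}
    (hS : S.ShortExact) {p : P} (h : IsFlasqueAt S.X₁ p) : IsMatchingSurjectiveAt S.g p :=
  .of_kernel S.f S.g (fun p => (shortExact_app hS p).moduleCat_injective_f)
    (fun p => (ShortComplex.ShortExact.moduleCat_exact_iff_function_exact _).1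
      (shortExact_app hS p).exact)
    (fun p => (shortExact_app hS p).moduleCat_surjective_g) h

/-- The constant functor at the free module of rank one. -/
abbrev constFree (P : Type u) [PartialOrder P] (R : Type u) [CommRing R] :
    Pᵒᵖ ⥤ ModuleCat.{u} R :=
  (Functor.const Pᵒᵖ).obj (ModuleCat.of R R)

/-- A map out of the constant functor is a compatible family on all of `P`, namely the images of 1.
-/
theorem exists_lift_constFree (hP : IsFilteredPoset P) {A B : Pᵒᵖ ⥤ ModuleCat.{u} R} (g : A ⟶ B)
    (hg : ∀ p, IsMatchingSurjectiveAt g p) (φ : constFree P R ⟶ B) :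
    ∃ ψ : constFree P R ⟶ A, ψ ≫ g = φ := by
  obtain ⟨s, hs, hst⟩ := exists_compatible_lift hP g (fun _ => True) (fun _ _ _ h => h)
    (fun p _ => hg p) (fun q => φ.app (op q) (1 : R)) (fun q r h _ => by
      rw [← app_map]; rfl)
  refine ⟨{ app := fun p => ModuleCat.ofHom (LinearMap.toSpanSingleton R _ (s p.unop))
            naturality := fun p q h => ?_ }, ?_⟩
  · ext
    simpa using (hs p.unop q.unop (leOfHom h.unop) trivial).symm.trans
      (ConcreteCategory.congr_hom (congrArg A.map (Subsingleton.elim _ h)) (s p.unop))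
  · ext p
    simpa using hst p.unop trivial

/-- Flasque functors have no higher `Ext` from the constant functor. -/
theorem subsingleton_ext_of_isFlasqueAt (hP : IsFilteredPoset P) (n : ℕ)
    (A : Pᵒᵖ ⥤ ModuleCat.{u} R) (hA : ∀ p, IsFlasqueAt A p) :
    Subsingleton (Ext (constFree P R) A (n + 1)) := by
  induction n generalizing A with
  | zero =>
    let S := ShortComplex.mk (Injective.ι A) (cokernel.π (Injective.ι A)) (by simp)
    have hS : S.ShortExact := { exact := ShortComplex.exact_cokernel _ }
    have : Subsingleton (Ext (constFree P R) S.X₂ 1) :=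
      Ext.subsingleton_of_injective _ (Injective.under A) 0
    exact subsingleton_ext_one_X₁ _ hS (exists_lift_constFree hP S.g fun p =>
      .of_shortExact hS (hA p))
  | succ n ih =>
    let S := ShortComplex.mk (Injective.ι A) (cokernel.π (Injective.ι A)) (by simp)
    have hS : S.ShortExact := { exact := ShortComplex.exact_cokernel _ }
    have : Subsingleton (Ext (constFree P R) S.X₂ (n + 1 + 1)) :=
      Ext.subsingleton_of_injective _ (Injective.under A) _
    -- The cokernel is flasque, being the quotient of a flasque functor by a flasque one.
    have : Subsingleton (Ext (constFree P R) S.X₃ (n + 1)) :=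
      ih _ fun p => .of_isMatchingSurjectiveAt hP S.g (isFlasqueAt_of_injective (Injective.under A) p)
        fun q _ => .of_shortExact hS (hA q)
    exact subsingleton_ext_X₁ _ hS (n + 1)

/-- The higher limits vanish when the corresponding `Ext` from the constant functor does. -/
theorem isZero_higherLimit_succ (F : Pᵒᵖ ⥤ ModuleCat.{u} R) (k : ℕ)
    [Subsingleton (Ext (constFree P R) F (k + 1))] : IsZero (higherLimit F (k + 1)) := by
  let I := injectiveResolution F
  refine IsZero.of_iso ?_ (I.isoRightDerivedObj (limFunctor P R) (k + 1))
  let K := ((limFunctor P R).mapHomologicalComplex (ComplexShape.up ℕ)).obj I.cocomplex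
  suffices h : K.ExactAt (k + 1) from (K.exactAt_iff_isZero_homology _).1 h
  rw [K.exactAt_iff' k (k + 1) (k + 2) (by simp) (by simp), ShortComplex.moduleCat_exact_iff]
  intro x hx
  let adj := constLimAdj (J := Pᵒᵖ) (C := ModuleCat.{u} R)
  -- Under the constant-limit adjunction a cocycle `x` in the limit becomes a map from the constant
  -- functor, that is, an `Ext` class. Its vanishing yields the coboundary.
  let y : ModuleCat.of R R ⟶ (lim : (Pᵒᵖ ⥤ ModuleCat.{u} R) ⥤ _).obj (I.cocomplex.X (k + 1)) :=
    ModuleCat.ofHom (LinearMap.toSpanSingleton R _ x)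
  have hy : y ≫ lim.map (I.cocomplex.d (k + 1) (k + 2)) = 0 := by
    ext
    exact (congrArg _ (one_smul R x)).trans hx
  have hz : (adj.homEquiv _ _).symm y ≫ I.cocomplex.d (k + 1) (k + 2) = 0 := by
    rw [← adj.homEquiv_naturality_right_symm, hy, adj.homEquiv_counit]
    simp
  obtain ⟨g, hg⟩ := (I.extMk_eq_zero_iff ((adj.homEquiv _ _).symm y) (k + 2) rfl hz k rfl).1
    (Subsingleton.elim _ _)
  refine ⟨(adj.homEquiv (ModuleCat.of R R) _ g) (1 : R), ?_⟩
  have : adj.homEquiv (ModuleCat.of R R) _ g ≫ lim.map (I.cocomplex.d k (k + 1)) = y := by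
    rw [← adj.homEquiv_naturality_right, hg, Equiv.apply_symm_apply]
  have := ConcreteCategory.congr_hom this (1 : R)
  exact this.trans (one_smul R x)

theorem isZero_higherLimit_zero {F : Pᵒᵖ ⥤ ModuleCat.{u} R} (hF : IsZero F) :
    IsZero (higherLimit F 0) :=
  ((limFunctor P R).map_isZero hF).of_iso ((limFunctor P R).rightDerivedZeroIsoSelf.app F)

end Acyclic

/-! ### Cycles and opcycles of a partly exact complex -/

section CochainComplex

variable {A : Type u} [Category.{v} A] [Abelian A] (K : CochainComplex A ℤ)

open HomologicalComplex

theorem iCycles_toCycles (i j : ℤ) : K.iCycles i ≫ K.toCycles i j = 0 := by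
  simp [← cancel_mono (K.iCycles j)]

theorem fromOpcycles_pOpcycles (i j : ℤ) : K.fromOpcycles i j ≫ K.pOpcycles j = 0 := by
  simp [← cancel_epi (K.pOpcycles i)]

variable {K}

theorem toCycles_naturality {L : CochainComplex A ℤ} (φ : K ⟶ L) (i j : ℤ) :
    φ.f i ≫ L.toCycles i j = K.toCycles i j ≫ cyclesMap φ j := by
  simp [← cancel_mono (L.iCycles j)]

theorem fromOpcycles_naturality {L : CochainComplex A ℤ} (φ : K ⟶ L) (i j : ℤ) :
    opcyclesMap φ i ≫ L.fromOpcycles i j = K.fromOpcycles i j ≫ φ.f j := by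
  simp [← cancel_epi (K.pOpcycles i)]

variable {i j : ℤ}

theorem isZero_cycles (h : IsZero (K.X i)) : IsZero (K.cycles i) :=
  h.of_mono (K.iCycles i)

theorem epi_toCycles (hij : i + 1 = j) (hK : K.ExactAt j) : Epi (K.toCycles i j) :=
  (ShortComplex.exact_of_g_is_cokernel (.mk (K.toCycles i j) (K.homologyπ j) (by simp))
    (K.homologyIsCokernel i j (by simp [← hij]))).epi_f (hK.isZero_homology.eq_of_tgt _ _)

theorem mono_fromOpcycles (hij : i + 1 = j) (hK : K.ExactAt i) : Mono (K.fromOpcycles i j) :=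
  (ShortComplex.exact_of_f_is_kernel (.mk (K.homologyι i) (K.fromOpcycles i j) (by simp))
    (K.homologyIsKernel i j (by simp [hij]))).mono_g (hK.isZero_homology.eq_of_src _ _)

theorem shortExact_iCycles_toCycles (hij : i + 1 = j) (hK : K.ExactAt j) :
    (ShortComplex.mk (K.iCycles i) (K.toCycles i j) (iCycles_toCycles K i j)).ShortExact where
  exact := by
    let ι : ShortComplex.mk (K.iCycles i) (K.toCycles i j) (iCycles_toCycles K i j) ⟶
        .mk (K.iCycles i) (K.d i j) (by simp) := { τ₁ := 𝟙 _, τ₂ := 𝟙 _, τ₃ := K.iCycles j }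
    rw [ShortComplex.exact_iff_of_epi_of_isIso_of_mono ι]
    exact ShortComplex.exact_of_f_is_kernel _ (K.cyclesIsKernel i j (by simp [hij]))
  mono_f := inferInstanceAs (Mono (K.iCycles i))
  epi_g := epi_toCycles hij hK

theorem shortExact_fromOpcycles_pOpcycles (hij : i + 1 = j) (hK : K.ExactAt i) :
    (ShortComplex.mk (K.fromOpcycles i j) (K.pOpcycles j)
      (fromOpcycles_pOpcycles K i j)).ShortExact where
  exact := by
    let π : ShortComplex.mk (K.d i j) (K.pOpcycles j) (by simp) ⟶
        .mk (K.fromOpcycles i j) (K.pOpcycles j) (fromOpcycles_pOpcycles K i j) :=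
      { τ₁ := K.pOpcycles i, τ₂ := 𝟙 _, τ₃ := 𝟙 _ }
    rw [← ShortComplex.exact_iff_of_epi_of_isIso_of_mono π]
    exact ShortComplex.exact_of_g_is_cokernel _ (K.opcyclesIsCokernel i j (by simp [← hij]))
  mono_f := mono_fromOpcycles hij hK
  epi_g := inferInstanceAs (Epi (K.pOpcycles j))

/-- Composing with the mono `K.iCycles j` does not change the kernel. Exactness is needed only at
`j`, so `i = 0` is allowed. -/
theorem shortExact_homologyι_opcyclesToCycles (hij : i + 1 = j) (hK : K.ExactAt j) :
    (ShortComplex.mk (K.homologyι i) (K.opcyclesToCycles i j) (by simp)).ShortExact where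
  exact := by
    let ι : ShortComplex.mk (K.homologyι i) (K.opcyclesToCycles i j) (by simp) ⟶
        .mk (K.homologyι i) (K.fromOpcycles i j) (by simp) :=
      { τ₁ := 𝟙 _, τ₂ := 𝟙 _, τ₃ := K.iCycles j }
    rw [ShortComplex.exact_iff_of_epi_of_isIso_of_mono ι]
    exact ShortComplex.exact_of_f_is_kernel _ (K.homologyIsKernel i j (by simp [hij]))
  mono_f := inferInstanceAs (Mono (K.homologyι i))
  epi_g := by
    have := epi_toCycles hij hK
    exact epi_of_epi_fac (K.pOpcycles_opcyclesToCycles i j)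

end CochainComplex

/-! ### Higher limits from degreewise flasque complexes -/

section Complexes

variable {P : Type u} [PartialOrder P] {R : Type u} [CommRing R]
  (X : Pᵒᵖ ⥤ CochainComplex (ModuleCat.{u} R) ℤ)

open HomologicalComplex

/-- The functor of degree `j` terms. -/
abbrev degreePart (j : ℤ) : Pᵒᵖ ⥤ ModuleCat.{u} R :=
  X ⋙ HomologicalComplex.eval _ _ j

/-- The functor of `j`-cycles. -/
abbrev cyclesPart (j : ℤ) : Pᵒᵖ ⥤ ModuleCat.{u} R :=
  X ⋙ cyclesFunctor _ _ j

/-- The functor of degree `j` terms modulo boundaries. -/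
abbrev opcyclesPart (j : ℤ) : Pᵒᵖ ⥤ ModuleCat.{u} R :=
  X ⋙ opcyclesFunctor _ _ j

/-- The sequence `Z^i ⟶ X^i ⟶ Z^j`. -/
@[simps]
def cyclesSequence (i j : ℤ) : ShortComplex (Pᵒᵖ ⥤ ModuleCat.{u} R) where
  X₁ := cyclesPart X i
  X₂ := degreePart X i
  X₃ := cyclesPart X j
  f := { app := fun p => (X.obj p).iCycles i
         naturality := fun _ _ f => cyclesMap_i (X.map f) i }
  g := { app := fun p => (X.obj p).toCycles i j
         naturality := fun _ _ f => toCycles_naturality (X.map f) i j }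
  zero := by ext p : 2; exact iCycles_toCycles _ i j

/-- The sequence `X^i / B^i ⟶ X^j ⟶ X^j / B^j`. -/
@[simps]
def opcyclesSequence (i j : ℤ) : ShortComplex (Pᵒᵖ ⥤ ModuleCat.{u} R) where
  X₁ := opcyclesPart X i
  X₂ := degreePart X j
  X₃ := opcyclesPart X j
  f := { app := fun p => (X.obj p).fromOpcycles i j
         naturality := fun _ _ f => fromOpcycles_naturality (X.map f) i j }
  g := { app := fun p => (X.obj p).pOpcycles j
         naturality := fun _ _ f => (p_opcyclesMap (X.map f) j).symm }
  zero := by ext p : 2; exact fromOpcycles_pOpcycles _ i j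

/-- The sequence `H^i ⟶ X^i / B^i ⟶ Z^j`. -/
@[simps]
def homologySequence (i j : ℤ) : ShortComplex (Pᵒᵖ ⥤ ModuleCat.{u} R) where
  X₁ := X ⋙ homologyFunctor _ _ i
  X₂ := opcyclesPart X i
  X₃ := cyclesPart X j
  f := Functor.whiskerLeft X (natTransHomologyι _ _ i)
  g := Functor.whiskerLeft X (natTransOpCyclesToCycles _ _ i j)
  zero := by ext p : 2; exact homologyι_opcyclesToCycles _ i j

variable {X}

/-- If the terms of a fibrant replacement are flasque and vanish from degree `k` on, then the
`Ext` groups in degree `k` vanish. -/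
theorem subsingleton_ext_of_flasque_complex (hP : IsFilteredPoset P)
    (hX : ∀ j p, IsFlasqueAt (degreePart X j) p) (hexact : ∀ p j, j ≠ 0 → (X.obj p).ExactAt j)
    (k : ℕ) (hk : ∀ p, IsZero ((X.obj p).X (k + 1 : ℕ))) :
    Subsingleton (Ext (constFree P R) (X ⋙ homologyFunctor _ _ 0) (k + 1)) := by
  -- Descends from `Z^{k+1} = 0`; `0 ≤ j` ensures exactness at `j + 1`.
  have hcycles (m : ℕ) : ∀ j : ℤ, 0 ≤ j → j + m = (k + 1 : ℕ) →
      Subsingleton (Ext (constFree P R) (cyclesPart X j) m) := by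
    induction m with
    | zero =>
      intro j _ hj
      obtain rfl : j = (k + 1 : ℕ) := by simpa using hj
      refine subsingleton_ext_of_isZero _ ((Functor.isZero_iff _).2 fun p => ?_) 0
      exact isZero_cycles (hk p)
    | succ m ih =>
      intro j hj hjm
      have : Subsingleton (Ext (constFree P R) (cyclesSequence X j (j + 1)).X₂ (m + 1)) :=
        subsingleton_ext_of_isFlasqueAt hP m _ (hX j)
      have : Subsingleton (Ext (constFree P R) (cyclesSequence X j (j + 1)).X₃ m) :=
        ih (j + 1) (by lia) (by push_cast at hjm ⊢; lia)
      exact subsingleton_ext_X₁ (S := cyclesSequence X j (j + 1)) _ (shortExact_of_forall_app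
        fun p => shortExact_iCycles_toCycles rfl (hexact p (j + 1) (by lia))) m
  -- The part of `X` in degrees at most `-i` is a flasque left resolution of `X^{-i}/B^{-i}`.
  have hop (i : ℕ) (p : P) : IsFlasqueAt (opcyclesPart X (-i)) p := by
    have hS (i : ℕ) : (opcyclesSequence X (-(i + 1 : ℕ)) (-i)).ShortExact :=
      shortExact_of_forall_app fun p => shortExact_fromOpcycles_pOpcycles (by simp)
        (hexact p _ (by lia))
    exact IsFlasqueAt.of_resolution hP (fun i => opcyclesPart X (-i)) (fun i => degreePart X (-i))
      (fun i => (opcyclesSequence X (-(i + 1 : ℕ)) (-i)).f)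
      (fun i => (opcyclesSequence X (-(i + 1 : ℕ)) (-i)).g)
      (fun i p => (shortExact_app (hS i) p).moduleCat_injective_f)
      (fun i p => (ShortComplex.ShortExact.moduleCat_exact_iff_function_exact _).1
        (shortExact_app (hS i) p).exact)
      (fun i p => (shortExact_app (hS i) p).moduleCat_surjective_g) (fun i => hX (-i)) i p
  have : Subsingleton (Ext (constFree P R) (homologySequence X 0 1).X₂ (k + 1)) :=
    subsingleton_ext_of_isFlasqueAt hP k _ (hop 0)
  have : Subsingleton (Ext (constFree P R) (homologySequence X 0 1).X₃ k) :=
    hcycles k 1 (by lia) (by push_cast; ring)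
  exact subsingleton_ext_X₁ (S := homologySequence X 0 1) _ (shortExact_of_forall_app
    fun p => shortExact_homologyι_opcyclesToCycles rfl (hexact p 1 one_ne_zero)) k

variable {F : Pᵒᵖ ⥤ ModuleCat.{u} R}

/-- A functor is the degree zero homology of any complex weakly equivalent to it. -/
def homologyIsoOfWeakEquivalence (η : inDegreeZero F ⟶ X) (hη : IsWeakEquivalence η) :
    F ≅ X ⋙ homologyFunctor _ _ 0 :=
  have (p : Pᵒᵖ) : IsIso ((Functor.whiskerRight η (homologyFunctor _ _ 0)).app p) := by
    have := hη p.unop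
    exact inferInstanceAs (IsIso (homologyMap (η.app p) 0))
  have := NatIso.isIso_of_isIso_app (Functor.whiskerRight η (homologyFunctor _ _ 0))
  F.rightUnitor.symm ≪≫ Functor.isoWhiskerLeft F (homologyFunctorSingleIso _ _ 0).symm ≪≫
    (Functor.associator _ _ _).symm ≪≫
    @asIso _ _ _ _ (Functor.whiskerRight η (homologyFunctor _ _ 0)) this

theorem exactAt_of_weakEquivalence (η : inDegreeZero F ⟶ X) (hη : IsWeakEquivalence η)
    (p : Pᵒᵖ) (j : ℤ) (hj : j ≠ 0) : (X.obj p).ExactAt j := by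
  have := hη p.unop
  exact (exactAt_iff_of_quasiIsoAt (η.app p) j).1 (exactAt_single_obj _ _ _ _ hj)

/-- The higher limits vanish from the first degree in which a degreewise flasque complex
weakly equivalent to the functor does. -/
theorem isZero_higherLimit_of_flasque_complex (hP : IsFilteredPoset P)
    (hX : ∀ j p, IsFlasqueAt (degreePart X j) p)
    (η : inDegreeZero F ⟶ X) (hη : IsWeakEquivalence η)
    (k : ℕ) (hk : ∀ p, IsZero ((X.obj p).X k)) : IsZero (higherLimit F k) := by
  let e := homologyIsoOfWeakEquivalence η hη
  cases k with
  | zero =>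
    -- If `X^0 = 0`, then `F`, being isomorphic to `H^0`, is itself zero.
    refine isZero_higherLimit_zero (IsZero.of_iso ((Functor.isZero_iff _).2 fun p => ?_) e)
    exact (ExactAt.of_isZero (hk p)).isZero_homology
  | succ k =>
    have := subsingleton_ext_of_flasque_complex hP hX (exactAt_of_weakEquivalence η hη) k hk
    have := subsingleton_ext_of_iso (constFree P R) e.symm (k + 1)
    exact isZero_higherLimit_succ F k

end Complexes

/-! ### Matching maps and compatible families -/

section MatchingSections

variable {P : Type w} [PartialOrder P] {C : Type u} [Category.{v} C] [HasLimitsOfSize.{w, w} C]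

/-- Surjectivity of a matching map after applying a limit-preserving functor to sets. -/
theorem surjective_map_matchingMap_iff (G : C ⥤ Type w) (X : Pᵒᵖ ⥤ C) (p : P)
    [PreservesLimit (restr X p) G] :
    Function.Surjective (G.map (matchingMap X p)) ↔
      ∀ s ∈ (restr X p ⋙ G).sections, ∃ x : G.obj (X.obj (op p)), ∀ q : {q : P // q < p},
        G.map (X.map (homOfLE q.2.le : q.1 ⟶ p).op) x = s (op q) := by
  let e := Types.isLimitEquivSections (isLimitOfPreserves G (limit.isLimit (restr X p)))
  have he (x : G.obj (X.obj (op p))) (q : {q : P // q < p}) :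
      (e (G.map (matchingMap X p) x)).1 (op q) =
        G.map (X.map (homOfLE q.2.le : q.1 ⟶ p).op) x := by
    change G.map (limit.π (restr X p) (op q)) (G.map (matchingMap X p) x) = _
    rw [← ConcreteCategory.comp_apply, ← G.map_comp, matchingMap_π]
    rfl
  constructor
  · intro h s hs
    obtain ⟨x, hx⟩ := h (e.symm ⟨s, hs⟩)
    refine ⟨x, fun q => ?_⟩
    rw [← he, hx, Equiv.apply_symm_apply]
  · intro h y
    obtain ⟨x, hx⟩ := h _ (e y).2
    refine ⟨x, e.injective (Subtype.ext (funext fun q => ?_))⟩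
    exact (he x q.unop).trans (hx q.unop)

end MatchingSections

/-! ### Fibrancy as degreewise flasqueness; heights -/

section Fibrant

variable {P : Type u} [PartialOrder P] {R : Type u} [CommRing R]

theorem isFlasqueAt_iff_sections (A : Pᵒᵖ ⥤ ModuleCat.{u} R) (p : P) :
    IsFlasqueAt A p ↔
      ∀ s ∈ (restr A p ⋙ forget (ModuleCat.{u} R)).sections, ∃ x : A.obj (op p),
        ∀ q : {q : P // q < p}, A.map (homOfLE q.2.le : q.1 ⟶ p).op x = s (op q) := by
  classical
  constructor
  · intro h s hs
    let t : ∀ q : P, A.obj (op q) := fun q => if hq : q < p then s (op ⟨q, hq⟩) else 0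
    have ht (q : P) (hq : q < p) : t q = s (op ⟨q, hq⟩) := dif_pos hq
    obtain ⟨x, hx⟩ := h t (fun q r h hq => by
      rw [ht q hq, ht r (h.trans_lt hq)]
      exact hs (homOfLE h : (⟨r, h.trans_lt hq⟩ : {q : P // q < p}) ⟶ ⟨q, hq⟩).op)
    exact ⟨x, fun q => (hx q.1 q.2).trans (ht q.1 q.2)⟩
  · intro h s hs
    obtain ⟨x, hx⟩ := h (fun q => s q.unop.1) (fun {q r} f =>
      hs q.unop.1 r.unop.1 (leOfHom f.unop) q.unop.2)
    exact ⟨x, fun q hq => hx ⟨q, hq⟩⟩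

theorem surjective_matchingMap_iff (A : Pᵒᵖ ⥤ ModuleCat.{u} R) (p : P) :
    Function.Surjective (matchingMap A p) ↔ IsFlasqueAt A p :=
  (surjective_map_matchingMap_iff (forget _) A p).trans (isFlasqueAt_iff_sections A p).symm

/-- Epimorphisms of complexes are detected degreewise, and evaluation in a degree followed by the
forgetful functor preserves the matching limit. -/
theorem epi_matchingMap_iff (X : Pᵒᵖ ⥤ CochainComplex (ModuleCat.{u} R) ℤ) (p : P) :
    Epi (matchingMap X p) ↔ ∀ j, IsFlasqueAt (degreePart X j) p := by
  have h : Epi (matchingMap X p) ↔ ∀ j, Epi ((matchingMap X p).f j) :=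
    ⟨fun _ j => inferInstanceAs (Epi ((HomologicalComplex.eval _ _ j).map (matchingMap X p))),
      fun h => HomologicalComplex.epi_of_epi_f _ h⟩
  refine h.trans (forall_congr' fun j => ?_)
  rw [ModuleCat.epi_iff_surjective, isFlasqueAt_iff_sections]
  exact surjective_map_matchingMap_iff (HomologicalComplex.eval _ _ j ⋙ forget _) X p

theorem isZero_matchingObj {X : Pᵒᵖ ⥤ CochainComplex (ModuleCat.{u} R) ℤ} (hX : IsZero X) (p : P) :
    IsZero (matchingObj X p) := by
  rw [IsZero.iff_id_eq_zero]
  exact limit.hom_ext fun q => ((Functor.isZero_iff _).1 hX _).eq_of_tgt _ _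

/-- Over a zero target the second projection of the pullback is an isomorphism. -/
theorem epi_relMatchingMap_iff {X Y : Pᵒᵖ ⥤ CochainComplex (ModuleCat.{u} R) ℤ} (η : X ⟶ Y)
    (hY : IsZero Y) (p : P) : Epi (relMatchingMap η p) ↔ Epi (matchingMap X p) := by
  have : IsIso (matchingMap Y p) :=
    ⟨0, ((Functor.isZero_iff _).1 hY _).eq_of_src _ _, (isZero_matchingObj hY p).eq_of_src _ _⟩
  have h : relMatchingMap η p ≫ pullback.snd (matchingMap Y p) (matchingObjMap η p) =
    matchingMap X p := pullback.lift_snd _ _ _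
  rw [← h]
  exact (epi_comp_iff_of_isIso _ _).symm

/-- A functor to complexes is fibrant if and only if it is degreewise flasque. -/
theorem isFibrant_iff (X : Pᵒᵖ ⥤ CochainComplex (ModuleCat.{u} R) ℤ) :
    IsFibrant X ↔ ∀ j p, IsFlasqueAt (degreePart X j) p := by
  have h (p : P) : Epi (relMatchingMap (terminal.from X) p) ↔
      ∀ j, IsFlasqueAt (degreePart X j) p :=
    (epi_relMatchingMap_iff _ ((isZero_zero _).of_iso (HasZeroObject.zeroIsoTerminal).symm) p).trans
      (epi_matchingMap_iff X p)
  exact (forall_congr' h).trans forall_comm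

theorem isFibrant_inDegreeZero_iff (F : Pᵒᵖ ⥤ ModuleCat.{u} R) :
    IsFibrant (inDegreeZero F) ↔ ∀ p : P, Function.Surjective (matchingMap F p) := by
  let e : degreePart (inDegreeZero F) 0 ≅ F :=
    Functor.isoWhiskerLeft F (HomologicalComplex.singleCompEvalIsoSelf _ (ComplexShape.up ℤ) 0) ≪≫
      F.rightUnitor
  simp_rw [isFibrant_iff, surjective_matchingMap_iff]
  refine ⟨fun h p => (h 0 p).of_retract e.inv e.hom e.inv_hom_id, fun h j p => ?_⟩
  obtain rfl | hj := eq_or_ne j 0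
  · exact (h p).of_retract e.hom e.inv e.hom_inv_id
  · refine fun s _ => ⟨0, fun q _ => ?_⟩
    have := ModuleCat.subsingleton_of_isZero
      (HomologicalComplex.isZero_single_obj_X (ComplexShape.up ℤ) 0 (F.obj (op q)) j hj)
    exact this.elim _ _

theorem isZero_X_of_height_lt (X : Pᵒᵖ ⥤ CochainComplex (ModuleCat.{u} R) ℤ) (k : ℤ)
    (h : height X < ((k : WithTop ℤ) : WithBot (WithTop ℤ))) (p : Pᵒᵖ) :
    IsZero ((X.obj p).X k) := by
  by_contra hk
  have h₁ : ((k : WithTop ℤ) : WithBot (WithTop ℤ)) ≤ complexHeight (X.obj p) :=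
    le_iSup (fun k : {k : ℤ // ¬ IsZero ((X.obj p).X k)} =>
      ((k.1 : WithTop ℤ) : WithBot (WithTop ℤ))) ⟨k, hk⟩
  have h₂ : complexHeight (X.obj p) ≤ height X :=
    le_iSup (fun p : P => complexHeight (X.obj (op p))) p.unop
  exact (h₁.trans h₂).not_gt h

end Fibrant

end PosetFunctor

end

theorem mainTheorem9 {P : Type u} [PartialOrder P] (hP : IsFilteredPoset P)
    {R : Type u} [CommRing R] (F : Pᵒᵖ ⥤ ModuleCat.{u} R) :
    (∀ (RF : Pᵒᵖ ⥤ CochainComplex (ModuleCat.{u} R) ℤ) (n : WithBot (WithTop ℤ)),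
      PosetFunctor.IsFibrantReplacement F RF → PosetFunctor.height RF = n →
        ∀ k : ℕ, n < (((k : ℤ) : WithTop ℤ) : WithBot (WithTop ℤ)) →
          IsZero (PosetFunctor.higherLimit F k)) ∧
    (PosetFunctor.IsFibrant (PosetFunctor.inDegreeZero F) ↔
      ∀ p : P, Function.Surjective (PosetFunctor.matchingMap F p)) ∧
    (PosetFunctor.IsFibrant (PosetFunctor.inDegreeZero F) →
      ∀ k : ℕ, 0 < k → IsZero (PosetFunctor.higherLimit F k)) := by
  refine ⟨?_, PosetFunctor.isFibrant_inDegreeZero_iff F, fun h k hk => ?_⟩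
  · rintro RF n ⟨hRF, η, hη⟩ rfl k hk
    exact PosetFunctor.isZero_higherLimit_of_flasque_complex hP
      ((PosetFunctor.isFibrant_iff RF).1 hRF) η hη k
      (PosetFunctor.isZero_X_of_height_lt RF k hk)
  · refine PosetFunctor.isZero_higherLimit_of_flasque_complex hP
      ((PosetFunctor.isFibrant_iff _).1 h) (𝟙 _) (fun p => ?_) k fun p => ?_
    · exact inferInstanceAs (QuasiIso (𝟙 ((PosetFunctor.inDegreeZero F).obj (op p))))
    · exact HomologicalComplex.isZero_single_obj_X _ _ _ _ (by exact_mod_cast hk.ne')
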